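/- Let $\Gamma$ be a countable discrete group acting continuously on a compact metrizable space $X$. Let $\mathcal M(X)$ be the space of Borel probability measures on $X$ with the weak$^*$-topology, regarded as a compact convex subset of $C(X)^*$, with the induced push-forward action of $\Gamma$; identify $x\in X$ with the Dirac measure $\delta_x\in\mathcal M(X)$, so that $X^k\subseteq \mathcal M(X)^k\subseteq (C(X)^*)^k$. Powers $X^n$ carry the diagonal action. For a continuous action of $\Gamma$ on a compact metrizable space $Y$, an integer $k\ge 1$ and subsets $A_1,\dots,A_k\subseteq Y$, a set $F\subseteq\Gamma$ is an independence set for $(A_1,\dots,A_k)$ if $\bigcap_{s\in J}s^{-1}A_{\sigma(s)}\ne\emptyset$ for every nonempty finite $J\subseteq F$ and every map $\sigma:J\to\{1,\dots,k\}$. A tuple $(y_1,\dots,y_k)\in Y^k$ is an IN-tuple if for all neighborhoods $U_j$ of $y_j$ ($1\le j\le k$) the tuple $(U_1,\dots,U_k)$ has arbitrarily large finite independence sets. Let $\mathrm{IN}_k(Y)\subseteq Y^k$ be the set of IN-tuples of length $k$. A measure $\mu\in\mathcal M(X^k)$ is an IN-measure if for every integer $n\ge 1$ and all $(x^{(i)}_1,\dots,x^{(i)}_k)\in\operatorname{supp}(\mu)$,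 $1\le i\le n$, one has $$\big((x_1^{(1)},\dots,x_1^{(n)}),\dots,(x_k^{(1)},\dots,x_k^{(n)})\big)\in \mathrm{IN}_k(X^n).$$ Let $\mathcal M_{\mathrm{IN}}(X^k)$ be the set of IN-measures, and for $\mu\in\mathcal M(X^k)$ let $\mu^{(j)}\in\mathcal M(X)$ be the push-forward of $\mu$ under the $j$-th coordinate map. **Theorem.** For every integer $k\ge 1$: 1. $\mathrm{IN}_k(\mathcal M(X))$ is contained in the closed convex hull of $\mathrm{IN}_k(X)$ in $\mathcal M(X)^k$. 2. $\mathrm{IN}_k(\mathcal M(X))\cap X^k=\mathrm{IN}_k(X)$. 3. $\mathrm{IN}_k(\mathcal M(X))=\{(\mu^{(1)},\dots,\mu^{(k)}):\mu\in\mathcal M_{\mathrm{IN}}(X^k)\}$. -/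

import Mathlib

open MeasureTheory Topology

noncomputable section

/-- The push-forward action of `Γ` on Borel probability measures: `g • μ = g_* μ`. -/
instance probabilityMeasureMulAction {Γ X : Type*} [Group Γ] [MeasurableSpace X] [MulAction Γ X]
    [MeasurableConstSMul Γ X] : MulAction Γ (ProbabilityMeasure X) where
  smul g μ := μ.map (measurable_const_smul g : Measurable (fun x : X => g • x)).aemeasurable
  one_smul μ := by
    apply Subtype.ext
    change Measure.map (fun x : X => (1 : Γ) • x) (μ : Measure X) = (μ : Measure X)
    simp
  mul_smul g h μ := by
    apply Subtype.ext
    change Measure.map (fun x : X => (g * h) • x) (μ : Measure X) =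
      Measure.map (fun x : X => g • x) (Measure.map (fun x : X => h • x) (μ : Measure X))
    rw [Measure.map_map (measurable_const_smul g) (measurable_const_smul h)]
    simp only [mul_smul, Function.comp_def]

/-- `F ⊆ Γ` is an independence set for the tuple `A = (A₁, …, A_k)` of subsets of `Y`:
for every nonempty finite `J ⊆ F` and every `σ : J → [k]`,
the intersection `⋂_{s ∈ J} s⁻¹ A_{σ(s)}` is nonempty. -/
def IsIndependenceSet {Γ Y : Type*} [Group Γ] [MulAction Γ Y] {k : ℕ}
    (A : Fin k → Set Y) (F : Set Γ) : Prop :=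
  ∀ J : Finset Γ, J.Nonempty → (J : Set Γ) ⊆ F → ∀ σ : J → Fin k,
    (⋂ s : J, (fun y : Y => (s : Γ) • y) ⁻¹' A (σ s)).Nonempty

/-- `IN_k(Y)`: the `k`-tuples all of whose product neighbourhoods have arbitrarily large finite
independence sets. -/
def INTuples (Γ Y : Type*) [Group Γ] [TopologicalSpace Y] [MulAction Γ Y] (k : ℕ) :
    Set (Fin k → Y) :=
  {y | ∀ U : Fin k → Set Y, (∀ j, U j ∈ 𝓝 (y j)) →
    ∀ N : ℕ, ∃ F : Finset Γ, N ≤ F.card ∧ IsIndependenceSet U (F : Set Γ)}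

/-- `M_IN(X^k)`: the Borel probability measures `μ` on `X^k` such that for all `n ≥ 1` and all
points `x⁽¹⁾, …, x⁽ⁿ⁾` of `supp μ`, the `k`-tuple of points of `X^n` whose `j`-th entry is
`(x_j⁽¹⁾, …, x_j⁽ⁿ⁾)` is an IN-tuple of `X^n` with the diagonal action. -/
def INMeasures (Γ X : Type*) [Group Γ] [TopologicalSpace X] [MeasurableSpace X] [MulAction Γ X]
    (k : ℕ) : Set (ProbabilityMeasure (Fin k → X)) :=
  {μ | ∀ n : ℕ, 1 ≤ n → ∀ x : Fin n → Fin k → X,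
    (∀ i, x i ∈ (μ : Measure (Fin k → X)).support) →
      (fun (j : Fin k) (i : Fin n) => x i j) ∈ INTuples Γ (Fin n → X) k}

/-- The `j`-th marginal `μ⁽ʲ⁾` of a probability measure on `X^k`. -/
def marginal {X : Type*} [MeasurableSpace X] {k : ℕ}
    (μ : ProbabilityMeasure (Fin k → X)) (j : Fin k) : ProbabilityMeasure X :=
  μ.map (measurable_pi_apply j).aemeasurable

/-- The embedding `M(X)^k → (C(X)^*)^k` (weak-* topology), given in each coordinate by
`μ ↦ (f ↦ ∫ f dμ)`. -/
def tupleToDual {X : Type*} [TopologicalSpace X] [CompactSpace X] [MeasurableSpace X]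
    [BorelSpace X] {k : ℕ} (ν : Fin k → ProbabilityMeasure X) :
    Fin k → WeakDual ℝ C(X, ℝ) := fun j =>
  StrongDual.toWeakDual <| LinearMap.mkContinuous
    { toFun := fun f : C(X, ℝ) => ∫ x, f x ∂(ν j : Measure X)
      map_add' := fun f g => integral_add
        (f.continuous.integrable_of_hasCompactSupport (HasCompactSupport.of_compactSpace f))
        (g.continuous.integrable_of_hasCompactSupport (HasCompactSupport.of_compactSpace g))
      map_smul' := fun c f => integral_const_mul c f } 1
    (fun f => by
      simpa using norm_integral_le_of_norm_le_const (μ := (ν j : Measure X))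
        (Filter.Eventually.of_forall fun x => f.norm_coe_le_norm x))

/-- The inclusion `X^k ⊆ M(X)^k`, sending each coordinate to its Dirac measure. -/
def tupleDirac {X : Type*} [MeasurableSpace X] {k : ℕ} (x : Fin k → X) :
    Fin k → ProbabilityMeasure X := fun j => diracProba (x j)

end

open ProbabilityTheory

/-! The crux is to realise an IN-tuple `μ` of measures as the marginals of an IN-measure
(`exists_INMeasure_of_mem_INTuples`). Independence gives elements `s 0, …, s p` and, for each word
`σ` of labels, a measure `ν σ` with every `s i • ν σ` close to `μ (σ i)`. Draw `σ` uniformly, then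
`x` from `ν σ`, and record the pairs `(σ i, s i • x)`. In a limit law `P` of these records, labels
at distinct indices have uncorrelated weights, and given label `j` the `i`-th point has law exactly
`μ j`.

Bounded uncorrelated weights become asymptotically independent of every fixed event. Hence, as `i`
grows along an ultrafilter, the conditional laws of the `i`-th point given label `j` converge to a
Markov kernel `κ j` over `P` (`exists_kernel_tendsto`). Mixing the products of the `κ j ω` over `P`
gives `M` with marginals `μ`. Near a point of its support, all the `κ j ω` charge the prescribed
neighbourhoods for a non-null set of `ω`. Indices can therefore be added one at a time while every
label pattern stays possible, for finitely many support points at once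
(`exists_injective_forall_measure_pos`). Using the same indices for all these points is exactly
independence in `X^n`.

Conversely, the law of large numbers makes an IN-measure a limit of averages over points of its
support. Averaging `X^n → M(X)` is continuous and equivariant, and IN-tuples form a closed set. The
same averages give the convex hull statement. In the Dirac case, a measure with Dirac marginals is
itself Dirac, and supports of IN-measures consist of IN-tuples. -/

/-! ### Permanence properties of IN-tuples. -/

/-- Continuous equivariant maps send IN-tuples to IN-tuples. -/
theorem INTuples.map {Γ Y Z : Type*} [Group Γ] [TopologicalSpace Y] [MulAction Γ Y]
    [TopologicalSpace Z] [MulAction Γ Z] {k : ℕ} {f : Y → Z} (hf : Continuous f)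
    (hequiv : ∀ (g : Γ) y, f (g • y) = g • f y) {y : Fin k → Y} (hy : y ∈ INTuples Γ Y k) :
    (fun j => f (y j)) ∈ INTuples Γ Z k := by
  intro U hU N
  obtain ⟨F, hN, hF⟩ := hy (fun j => f ⁻¹' U j)
    (fun j => hf.continuousAt.preimage_mem_nhds (hU j)) N
  refine ⟨F, hN, fun J hJ hJF σ => ?_⟩
  obtain ⟨z, hz⟩ := hF J hJ hJF σ
  refine ⟨f z, Set.mem_iInter.2 fun s => ?_⟩
  have := Set.mem_iInter.1 hz s
  simpa [hequiv] using this

/-- A tuple all of whose neighbourhoods contain IN-tuples is an IN-tuple. -/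
theorem mem_INTuples_of_forall_nhds {Γ Y : Type*} [Group Γ] [TopologicalSpace Y] [MulAction Γ Y]
    {k : ℕ} {y : Fin k → Y}
    (h : ∀ U : Fin k → Set Y, (∀ j, U j ∈ 𝓝 (y j)) → ∃ z ∈ INTuples Γ Y k, ∀ j, U j ∈ 𝓝 (z j)) :
    y ∈ INTuples Γ Y k := by
  intro U hU N
  obtain ⟨z, hz, hzU⟩ := h U hU
  exact hz U hzU N

/-! ### Generic sequences and empirical measures. -/

/-- A probability measure on a compact metrizable space has a generic sequence in its support. -/
theorem exists_seq_support_tendsto_average {Y : Type*} [TopologicalSpace Y] [CompactSpace Y]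
    [TopologicalSpace.MetrizableSpace Y] [MeasurableSpace Y] [BorelSpace Y]
    (μ : Measure Y) [IsProbabilityMeasure μ] :
    ∃ x : ℕ → Y, (∀ i, x i ∈ μ.support) ∧ ∀ f : C(Y, ℝ),
      Filter.Tendsto (fun n : ℕ => (n : ℝ)⁻¹ * ∑ i ∈ Finset.range n, f (x i)) Filter.atTop
        (𝓝 (∫ y, f y ∂μ)) := by
  let := TopologicalSpace.metrizableSpaceMetric Y
  let P : Measure (ℕ → Y) := Measure.infinitePi fun _ => μ
  have hmp : ∀ i, MeasurePreserving (fun ω : ℕ → Y => ω i) P μ := fun i =>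
    measurePreserving_eval_infinitePi (fun _ => μ) i
  have hsupp : ∀ᵐ ω ∂P, ∀ i, ω i ∈ μ.support :=
    ae_all_iff.2 fun i => (hmp i).quasiMeasurePreserving.ae Measure.support_mem_ae
  have hind : ProbabilityTheory.iIndepFun (fun (i : ℕ) (ω : ℕ → Y) => ω i) P := by
    exact ProbabilityTheory.iIndepFun_infinitePi (X := fun _ y => y) (fun i => measurable_id)
  have hlaw : ∀ f : C(Y, ℝ), ∀ᵐ ω ∂P,
      Filter.Tendsto (fun n : ℕ => (n : ℝ)⁻¹ * ∑ i ∈ Finset.range n, f (ω i)) Filter.atTop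
        (𝓝 (∫ y, f y ∂μ)) := by
    intro f
    have hint : Integrable f μ := f.continuous.integrable_of_hasCompactSupport
      (HasCompactSupport.of_compactSpace f)
    have key := ProbabilityTheory.strong_law_ae_real (μ := P) (fun i ω => f (ω i))
      ((hmp 0).integrable_comp_of_integrable hint)
      (fun i i' hii' => (hind.indepFun hii').comp f.continuous.measurable f.continuous.measurable)
      (fun i => by
        have h1 : ProbabilityTheory.IdentDistrib (fun ω : ℕ → Y => ω i) (fun ω => ω 0) P P :=
          ⟨(hmp i).aemeasurable, (hmp 0).aemeasurable, by rw [(hmp i).map_eq, (hmp 0).map_eq]⟩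
        exact h1.comp f.continuous.measurable)
    have h0 : ∫ ω, f (ω 0) ∂P = ∫ y, f y ∂μ := by
      rw [← (hmp 0).map_eq, integral_map (hmp 0).aemeasurable]
      exact f.continuous.aestronglyMeasurable
    rw [h0] at key
    filter_upwards [key] with ω hω
    simpa [div_eq_inv_mul] using hω
  -- The null set in `hlaw` depends on `f`; a countable dense family allows one sample to serve all
  -- `f`, by an `ε / 3` argument.
  obtain ⟨D, hDc, hDd⟩ := TopologicalSpace.exists_countable_dense C(Y, ℝ)
  have hall : ∀ᵐ ω ∂P, ∀ f ∈ D,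
      Filter.Tendsto (fun n : ℕ => (n : ℝ)⁻¹ * ∑ i ∈ Finset.range n, f (ω i)) Filter.atTop
        (𝓝 (∫ y, f y ∂μ)) := (ae_ball_iff hDc).2 fun f _ => hlaw f
  obtain ⟨x, hx, hxD⟩ := (hsupp.and hall).exists
  refine ⟨x, hx, fun f => ?_⟩
  rw [Metric.tendsto_atTop]
  intro ε hε
  obtain ⟨g, hgD, hg⟩ := Metric.dense_iff.1 hDd f (ε / 3) (by positivity)
  have hfg : ∀ y, |f y - g y| ≤ ε / 3 := fun y => by
    have := (ContinuousMap.dist_apply_le_dist (f := g) (g := f) y).trans (Metric.mem_ball.1 hgD).le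
    rwa [dist_comm, Real.dist_eq] at this
  have hintf : Integrable f μ := f.continuous.integrable_of_hasCompactSupport
    (HasCompactSupport.of_compactSpace f)
  have hintg : Integrable g μ := g.continuous.integrable_of_hasCompactSupport
    (HasCompactSupport.of_compactSpace g)
  obtain ⟨N, hN⟩ := Metric.tendsto_atTop.1 (hxD g hg) (ε / 3) (by positivity)
  refine ⟨N, fun n hn => ?_⟩
  have h1 := hN n hn
  have h2 : |∫ y, f y ∂μ - ∫ y, g y ∂μ| ≤ ε / 3 := by
    rw [← integral_sub hintf hintg]
    simpa using norm_integral_le_of_norm_le_const (μ := μ) (f := fun y => f y - g y)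
      (Filter.Eventually.of_forall hfg)
  have h3 : |(n : ℝ)⁻¹ * ∑ i ∈ Finset.range n, f (x i) -
      (n : ℝ)⁻¹ * ∑ i ∈ Finset.range n, g (x i)| ≤ ε / 3 := by
    rw [← mul_sub, ← Finset.sum_sub_distrib, abs_mul, abs_of_nonneg (by positivity)]
    calc (n : ℝ)⁻¹ * |∑ i ∈ Finset.range n, (f (x i) - g (x i))|
        ≤ (n : ℝ)⁻¹ * (n * (ε / 3)) := by
          gcongr
          refine (Finset.abs_sum_le_sum_abs _ _).trans ?_
          simpa using Finset.sum_le_sum (s := Finset.range n) fun i _ => hfg (x i)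
      _ ≤ ε / 3 := by
          rw [← mul_assoc]
          rcases eq_or_ne (n : ℝ) 0 with h | h
          · simp [h]; positivity
          · rw [inv_mul_cancel₀ h, one_mul]
  rw [Real.dist_eq] at h1 ⊢
  have h2' := abs_le.1 h2
  have h3' := abs_le.1 h3
  have h1' := abs_lt.1 h1
  rw [abs_lt]
  constructor <;> linarith [h1'.1, h1'.2, h2'.1, h2'.2, h3'.1, h3'.2]

/-- The empirical measure of a nonempty finite family of points. -/
noncomputable def empiricalMeasure {X : Type*} [MeasurableSpace X] {n : ℕ} (x : Fin (n + 1) → X) :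
    ProbabilityMeasure X :=
  ⟨(PMF.uniformOfFintype (Fin (n + 1))).toMeasure.map x,
    Measure.isProbabilityMeasure_map (measurable_of_countable x).aemeasurable⟩

theorem integral_empiricalMeasure {X : Type*} [MeasurableSpace X] {n : ℕ} (x : Fin (n + 1) → X)
    {f : X → ℝ} (hf : StronglyMeasurable f) :
    ∫ y, f y ∂(empiricalMeasure x : Measure X) = ((n + 1 : ℕ) : ℝ)⁻¹ * ∑ i, f (x i) := by
  change ∫ y, f y ∂((PMF.uniformOfFintype (Fin (n + 1))).toMeasure.map x) = _
  rw [integral_map (measurable_of_countable x).aemeasurable hf.aestronglyMeasurable,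
    PMF.integral_eq_sum, Finset.mul_sum]
  refine Finset.sum_congr rfl fun i _ => ?_
  rw [PMF.uniformOfFintype_apply, ENNReal.toReal_inv, Fintype.card_fin, ENNReal.toReal_natCast,
    smul_eq_mul]

theorem continuous_empiricalMeasure {X : Type*} [TopologicalSpace X]
    [TopologicalSpace.PseudoMetrizableSpace X] [MeasurableSpace X]
    [BorelSpace X] {n : ℕ} :
    Continuous (empiricalMeasure : (Fin (n + 1) → X) → ProbabilityMeasure X) := by
  rw [ProbabilityMeasure.continuous_iff_forall_continuous_integral]
  intro f
  simp_rw [fun x : Fin (n + 1) → X =>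
    integral_empiricalMeasure x f.continuous.measurable.stronglyMeasurable]
  fun_prop

theorem empiricalMeasure_smul {Γ X : Type*} [Group Γ] [MeasurableSpace X] [MulAction Γ X]
    [MeasurableConstSMul Γ X] {n : ℕ} (g : Γ) (x : Fin (n + 1) → X) :
    empiricalMeasure (g • x) = g • empiricalMeasure x := by
  apply Subtype.ext
  change Measure.map (g • x) _ = Measure.map (fun y : X => g • y) (Measure.map x _)
  rw [Measure.map_map (measurable_const_smul g) (measurable_of_countable x)]
  rfl

theorem diracProba_smul {Γ X : Type*} [Group Γ] [MeasurableSpace X] [MulAction Γ X]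
    [MeasurableConstSMul Γ X] (g : Γ) (x : X) : diracProba (g • x) = g • diracProba x := by
  apply Subtype.ext
  change Measure.dirac (g • x) = Measure.map (fun y : X => g • y) (Measure.dirac x)
  rw [Measure.map_dirac' (measurable_const_smul g)]

theorem integral_marginal {X : Type*} [MeasurableSpace X] {k : ℕ}
    (μ : ProbabilityMeasure (Fin k → X)) (j : Fin k) {f : X → ℝ} (hf : StronglyMeasurable f) :
    ∫ x, f x ∂(marginal μ j : Measure X) = ∫ y, f (y j) ∂(μ : Measure (Fin k → X)) :=
  integral_map (measurable_pi_apply j).aemeasurable hf.aestronglyMeasurable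

/-! ### Consequences of being an IN-measure. -/

/-- The tuple of marginals of an IN-measure is an IN-tuple. -/
theorem marginal_mem_INTuples {Γ X : Type*} [Group Γ] [TopologicalSpace X] [CompactSpace X]
    [TopologicalSpace.MetrizableSpace X] [MeasurableSpace X] [BorelSpace X] [MulAction Γ X]
    [ContinuousConstSMul Γ X] {k : ℕ}
    {μ : ProbabilityMeasure (Fin k → X)} (hμ : μ ∈ INMeasures Γ X k) :
    marginal μ ∈ INTuples Γ (ProbabilityMeasure X) k := by
  let := TopologicalSpace.metrizableSpaceMetric X
  obtain ⟨x, hx, hlim⟩ := exists_seq_support_tendsto_average (μ : Measure (Fin k → X))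
  have hconv : ∀ j, Filter.Tendsto
      (fun n : ℕ => empiricalMeasure fun i : Fin (n + 1) => x i j) Filter.atTop
      (𝓝 (marginal μ j)) := by
    intro j
    rw [ProbabilityMeasure.tendsto_iff_forall_integral_tendsto]
    intro f
    have hf : StronglyMeasurable f := f.continuous.measurable.stronglyMeasurable
    rw [integral_marginal μ j hf]
    have := (hlim ⟨fun y => f (y j), by fun_prop⟩).comp (Filter.tendsto_add_atTop_nat 1)
    refine this.congr fun n => ?_
    rw [integral_empiricalMeasure _ hf]
    simp [Finset.sum_range]
  refine mem_INTuples_of_forall_nhds fun U hU => ?_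
  obtain ⟨n, hn⟩ := (Filter.eventually_all.2 fun j =>
    (hconv j).eventually (eventually_mem_nhds_iff.2 (hU j))).exists
  -- The first `n + 1` sample points form an IN-tuple of `X^(n+1)`, which averaging carries to an
  -- IN-tuple of measures.
  exact ⟨_, INTuples.map continuous_empiricalMeasure empiricalMeasure_smul
    (hμ (n + 1) (by omega) (fun i => x i) fun i => hx i), hn⟩

/-- The support of an IN-measure consists of IN-tuples. -/
theorem support_subset_INTuples {Γ X : Type*} [Group Γ] [TopologicalSpace X]
    [MeasurableSpace X] [MulAction Γ X] {k : ℕ}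
    {μ : ProbabilityMeasure (Fin k → X)} (hμ : μ ∈ INMeasures Γ X k) :
    (μ : Measure (Fin k → X)).support ⊆ INTuples Γ X k := by
  intro x hx
  exact INTuples.map (f := fun y : Fin 1 → X => y 0) (continuous_apply 0) (fun _ _ => rfl)
    (hμ 1 le_rfl (fun _ => x) fun _ => hx)

theorem tupleDirac_mem_INTuples {Γ X : Type*} [Group Γ] [TopologicalSpace X]
    [MeasurableSpace X] [BorelSpace X] [MulAction Γ X] [ContinuousConstSMul Γ X] {k : ℕ}
    {x : Fin k → X} (hx : x ∈ INTuples Γ X k) :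
    tupleDirac x ∈ INTuples Γ (ProbabilityMeasure X) k := by
  exact INTuples.map continuous_diracProba diracProba_smul hx

/-- Each coordinate is almost surely constant, so the joint law is the point mass at `x`: Dirac
measures have only one coupling. -/
theorem mem_support_of_marginal_eq_tupleDirac {X : Type*} [TopologicalSpace X]
    [T1Space X] [MeasurableSpace X] [BorelSpace X] {k : ℕ}
    {μ : ProbabilityMeasure (Fin k → X)} {x : Fin k → X}
    (h : marginal μ = tupleDirac x) : x ∈ (μ : Measure (Fin k → X)).support := by
  have hae : ∀ᵐ y ∂(μ : Measure (Fin k → X)), y = x := by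
    have : ∀ j, ∀ᵐ y ∂(μ : Measure (Fin k → X)), y j = x j := fun j => by
      have hj : (μ : Measure (Fin k → X)).map (fun y => y j) = Measure.dirac (x j) :=
        congrArg Subtype.val (congrFun h j)
      have hd : ∀ᵐ z ∂Measure.dirac (x j), z = x j := by
        rw [ae_dirac_eq]; rfl
      rw [← hj] at hd
      exact ae_of_ae_map (measurable_pi_apply j).aemeasurable hd
    filter_upwards [ae_all_iff.2 this] with y hy using funext hy
  rw [Measure.mem_support_iff_forall]
  intro U hU
  have : (μ : Measure (Fin k → X)) U = 1 := by
    refine le_antisymm prob_le_one ?_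
    rw [← measure_univ (μ := (μ : Measure (Fin k → X)))]
    refine measure_mono_ae ?_
    filter_upwards [hae] with y hy _
    subst hy
    exact mem_of_mem_nhds hU
  rw [this]
  exact one_pos

/-- The marginals of a measure lie in the closed convex hull of any set of Dirac tuples that
contains those of the points of the support. -/
theorem tupleToDual_marginal_mem_closedConvexHull {X : Type*} [TopologicalSpace X]
    [CompactSpace X] [TopologicalSpace.MetrizableSpace X] [MeasurableSpace X] [BorelSpace X]
    {k : ℕ}
    {μ : ProbabilityMeasure (Fin k → X)}
    {S : Set (Fin k → X)} (hμ : (μ : Measure (Fin k → X)).support ⊆ S) :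
    tupleToDual (marginal μ) ∈ closedConvexHull ℝ (tupleToDual '' (tupleDirac '' S)) := by
  let := TopologicalSpace.metrizableSpaceMetric X
  obtain ⟨x, hx, hlim⟩ := exists_seq_support_tendsto_average (μ : Measure (Fin k → X))
  have hmem : ∀ n : ℕ, ∑ i ∈ Finset.range (n + 1), ((n + 1 : ℕ) : ℝ)⁻¹ •
      tupleToDual (tupleDirac (x i)) ∈ closedConvexHull ℝ (tupleToDual '' (tupleDirac '' S)) := by
    intro n
    refine convex_closedConvexHull.sum_mem (fun _ _ => by positivity) ?_ fun i _ =>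
      subset_closedConvexHull ⟨_, ⟨x i, hμ (hx i), rfl⟩, rfl⟩
    simp only [Finset.sum_const, Finset.card_range, nsmul_eq_mul]
    exact mul_inv_cancel₀ (by positivity)
  refine isClosed_closedConvexHull.mem_of_tendsto (b := Filter.atTop) ?_
    (Filter.Eventually.of_forall hmem)
  rw [tendsto_pi_nhds]
  intro j
  refine (tendsto_iff_forall_eval_tendsto_topDualPairing).2 ?_
  intro f
  have hf : StronglyMeasurable f := f.continuous.measurable.stronglyMeasurable
  change Filter.Tendsto _ _ (𝓝 (tupleToDual (marginal μ) j f))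
  have h1 : tupleToDual (marginal μ) j f = ∫ y, f (y j) ∂(μ : Measure (Fin k → X)) :=
    integral_marginal μ j hf
  have h2 : ∀ i, tupleToDual (tupleDirac (x i)) j f = f (x i j) := fun i =>
    integral_dirac' f (x i j) hf
  rw [h1]
  have := (hlim ⟨fun y => f (y j), by fun_prop⟩).comp (Filter.tendsto_add_atTop_nat 1)
  refine this.congr fun n => ?_
  change _ = (∑ i ∈ Finset.range (n + 1), ((n + 1 : ℕ) : ℝ)⁻¹ •
      tupleToDual (tupleDirac (x i))) j f
  have h3 : (∑ i ∈ Finset.range (n + 1), ((n + 1 : ℕ) : ℝ)⁻¹ •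
      tupleToDual (tupleDirac (x i))) j f = ∑ i ∈ Finset.range (n + 1), ((n + 1 : ℕ) : ℝ)⁻¹ •
      tupleToDual (tupleDirac (x i)) j f := by
    rw [Finset.sum_apply]
    exact map_sum ((topDualPairing ℝ C(X, ℝ)).flip f) _ _
  rw [h3]
  simp [h2, Finset.mul_sum]

/-! ### Orthogonal weights and limiting kernels. -/

/-- Bounded orthogonal sequences tend weakly to zero. -/
theorem tendsto_inner_zero_of_orthogonal {E : Type*} [NormedAddCommGroup E] [InnerProductSpace ℝ E]
    {u : ℕ → E} {C : ℝ} (hC : ∀ i, ‖u i‖ ≤ C)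
    (hu : Pairwise fun i j => inner ℝ (u i) (u j) = 0) (g : E) :
    Filter.Tendsto (fun i => inner ℝ (u i) g) Filter.atTop (𝓝 0) := by
  set c : ℕ → ℝ := fun i => inner ℝ (u i) g with hc
  -- The `u i` are not normalised and may vanish. Damping by `t` with `t * C ^ 2 ≤ 1` ensures that
  -- subtracting `(t * c i) • u i` lowers the squared norm of the remainder by at least `t * c i ^
  -- 2`, a Bessel inequality.
  set t : ℝ := (1 + C ^ 2)⁻¹ with ht
  have htpos : 0 < t := by positivity
  have htC : t * C ^ 2 ≤ 1 := by
    rw [ht, inv_mul_le_iff₀ (by positivity)]; linarith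
  let R : ℕ → E := fun n => g - ∑ i ∈ Finset.range n, (t * c i) • u i
  have hR : ∀ n, inner ℝ (u n) (R n) = c n := by
    intro n
    simp only [R, inner_sub_right, inner_sum, inner_smul_right]
    rw [Finset.sum_eq_zero, sub_zero]
    intro i hi
    rw [hu (Finset.mem_range.1 hi).ne', mul_zero]
  have hbound : ∀ n, t * ∑ i ∈ Finset.range n, c i ^ 2 ≤ ‖g‖ ^ 2 - ‖R n‖ ^ 2 := by
    intro n
    induction n with
    | zero => simp [R]
    | succ n ih =>
      have hstep : R (n + 1) = R n - (t * c n) • u n := by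
        simp only [R, Finset.sum_range_succ]; abel
      have hn : ‖R (n + 1)‖ ^ 2 = ‖R n‖ ^ 2 - 2 * (t * c n * c n) + (t * c n) ^ 2 * ‖u n‖ ^ 2 := by
        rw [hstep, norm_sub_sq_real, inner_smul_right, real_inner_comm, hR, norm_smul, mul_pow,
          Real.norm_eq_abs, sq_abs]
      have hle : (t * c n) ^ 2 * ‖u n‖ ^ 2 ≤ t * c n ^ 2 := by
        have : ‖u n‖ ^ 2 ≤ C ^ 2 := pow_le_pow_left₀ (norm_nonneg _) (hC n) 2
        calc (t * c n) ^ 2 * ‖u n‖ ^ 2 ≤ (t * c n) ^ 2 * C ^ 2 := by gcongr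
          _ = (t * C ^ 2) * (t * c n ^ 2) := by ring
          _ ≤ 1 * (t * c n ^ 2) := by gcongr
          _ = _ := one_mul _
      rw [Finset.sum_range_succ, hn]
      nlinarith
  have hsum : Summable fun i => c i ^ 2 := by
    refine summable_of_sum_range_le (c := t⁻¹ * ‖g‖ ^ 2) (fun _ => sq_nonneg _) fun n => ?_
    rw [← div_eq_inv_mul, le_div_iff₀' htpos]
    nlinarith [hbound n, sq_nonneg ‖R n‖]
  have := hsum.tendsto_atTop_zero.sqrt
  simp only [Real.sqrt_sq_eq_abs, Real.sqrt_zero] at this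
  exact (tendsto_zero_iff_abs_tendsto_zero _).2 this

theorem tendsto_integral_mul_zero_of_orthogonal {Ω : Type*} [MeasurableSpace Ω] {P : Measure Ω}
    [IsFiniteMeasure P] {u : ℕ → Ω → ℝ} {C : ℝ} (hu : ∀ i, Measurable (u i))
    (hC : ∀ i ω, |u i ω| ≤ C) (horth : Pairwise fun i j => ∫ ω, u i ω * u j ω ∂P = 0) {g : Ω → ℝ}
    (hg : MemLp g 2 P) : Filter.Tendsto (fun i => ∫ ω, u i ω * g ω ∂P) Filter.atTop (𝓝 0) := by
  have hmem : ∀ i, MemLp (u i) 2 P := fun i =>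
    MemLp.of_bound (hu i).aestronglyMeasurable C (Filter.Eventually.of_forall (hC i))
  have hinner : ∀ i {h : Ω → ℝ} (hh : MemLp h 2 P),
      inner ℝ ((hmem i).toLp (u i)) (hh.toLp h) = ∫ ω, u i ω * h ω ∂P := by
    intro i h hh
    rw [L2.inner_def]
    refine integral_congr_ae ?_
    filter_upwards [(hmem i).coeFn_toLp, hh.coeFn_toLp] with ω h1 h2
    rw [h1, h2]
    simp [mul_comm]
  have := tendsto_inner_zero_of_orthogonal (u := fun i => (hmem i).toLp (u i))
    (C := (measureUnivNNReal P : ℝ) ^ (2⁻¹ : ℝ) * C) (fun i => ?_) (fun i j hij => ?_) (hg.toLp g)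
  · simpa only [hinner] using this
  · have hC0 : 0 ≤ C ∨ IsEmpty Ω := by
      rcases isEmpty_or_nonempty Ω with h | ⟨⟨ω⟩⟩
      · exact Or.inr h
      · exact Or.inl ((abs_nonneg _).trans (hC 0 ω))
    rcases hC0 with hC0 | h
    · have := Lp.norm_le_of_ae_bound (f := (hmem i).toLp (u i)) hC0 (by
        filter_upwards [(hmem i).coeFn_toLp] with ω h1
        rw [h1]; exact hC i ω)
      simpa [measureUnivNNReal] using this
    · have : P = 0 := Measure.eq_zero_of_isEmpty P
      subst this
      simp [Lp.norm_def]
  · exact (hinner i (hmem j)).trans (horth hij)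

theorem abs_integral_sub_le_of_abs_sub_le {Ω : Type*} [MeasurableSpace Ω] {P : Measure Ω}
    {a b c : Ω → ℝ} (ha : Integrable a P) (hb : Integrable b P) (hc : Integrable c P)
    (h : ∀ ω, |a ω - b ω| ≤ c ω) : |∫ ω, a ω ∂P - ∫ ω, b ω ∂P| ≤ ∫ ω, c ω ∂P := by
  rw [← integral_sub ha hb]
  exact norm_integral_le_of_norm_le (f := fun ω => a ω - b ω) hc (Filter.Eventually.of_forall h)

/-- The probability measure with density `w`, pushed to the graph of `ξ`. -/
theorem integral_map_graph_withDensity {Ω X : Type*} [MeasurableSpace Ω] [MeasurableSpace X]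
    (P : Measure Ω) {w : Ω → ℝ} (hw : Measurable w) (h0 : ∀ ω, 0 ≤ w ω) {ξ : Ω → X}
    (hξ : Measurable ξ) {F : Ω × X → ℝ} (hF : StronglyMeasurable F) :
    ∫ z, F z ∂((P.withDensity fun ω => ENNReal.ofReal (w ω)).map fun ω => (ω, ξ ω)) =
      ∫ ω, w ω * F (ω, ξ ω) ∂P := by
  rw [integral_map (by fun_prop) hF.aestronglyMeasurable,
    integral_withDensity_eq_integral_toReal_smul (by fun_prop) (by simp)]
  simp [ENNReal.toReal_ofReal (h0 _)]

/-- The conditional distributions of a sequence `ξ i` given everything else, along an ultrafilter: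
for weights `w i` that are asymptotically independent of everything, the weak limit of
`w i * f (ξ i)` is the integral of `f` against a Markov kernel. -/
theorem exists_kernel_tendsto {Ω X : Type*} [TopologicalSpace Ω] [CompactSpace Ω]
    [TopologicalSpace.MetrizableSpace Ω] [MeasurableSpace Ω] [BorelSpace Ω] [TopologicalSpace X]
    [CompactSpace X] [TopologicalSpace.MetrizableSpace X] [MeasurableSpace X] [BorelSpace X]
    [Nonempty X] (P : Measure Ω) [IsProbabilityMeasure P] {l : Ultrafilter ℕ}
    (hl : ↑l ≤ (Filter.atTop : Filter ℕ)) {w : ℕ → Ω → ℝ} {C : ℝ} (hw : ∀ i, Measurable (w i))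
    (h0 : ∀ i ω, 0 ≤ w i ω) (hC : ∀ i ω, w i ω ≤ C) (h1 : ∀ i, ∫ ω, w i ω ∂P = 1)
    (horth : Pairwise fun i j => ∫ ω, (w i ω - 1) * (w j ω - 1) ∂P = 0) {ξ : ℕ → Ω → X}
    (hξ : ∀ i, Measurable (ξ i)) :
    ∃ κ : Kernel Ω X, IsMarkovKernel κ ∧ ∀ (g : Ω → ℝ) (B : ℝ), Measurable g → (∀ ω, |g ω| ≤ B) →
      ∀ f : C(X, ℝ), Filter.Tendsto (fun i => ∫ ω, w i ω * (g ω * f (ξ i ω)) ∂P) l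
        (𝓝 (∫ ω, g ω * ∫ x, f x ∂(κ ω) ∂P)) := by
  let := TopologicalSpace.metrizableSpaceMetric Ω
  let := TopologicalSpace.metrizableSpaceMetric X
  have hwint : ∀ i, Integrable (w i) P := fun i =>
    Integrable.of_bound (hw i).aestronglyMeasurable C (Filter.Eventually.of_forall fun ω => by
      rw [Real.norm_eq_abs, abs_of_nonneg (h0 i ω)]; exact hC i ω)
  let Q : ℕ → ProbabilityMeasure (Ω × X) := fun i =>
    ⟨(P.withDensity fun ω => ENNReal.ofReal (w i ω)).map fun ω => (ω, ξ i ω), by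
      have : IsProbabilityMeasure (P.withDensity fun ω => ENNReal.ofReal (w i ω)) := by
        constructor
        rw [withDensity_apply _ MeasurableSet.univ, Measure.restrict_univ,
          ← ofReal_integral_eq_lintegral_ofReal (hwint i) (Filter.Eventually.of_forall (h0 i)),
          h1, ENNReal.ofReal_one]
      exact Measure.isProbabilityMeasure_map (by fun_prop)⟩
  have hQ : ∀ i {F : Ω × X → ℝ}, StronglyMeasurable F →
      ∫ z, F z ∂(Q i : Measure (Ω × X)) = ∫ ω, w i ω * F (ω, ξ i ω) ∂P := fun i F hF =>
    integral_map_graph_withDensity P (hw i) (h0 i) (hξ i) hF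
  obtain ⟨R, -, hR⟩ := isCompact_univ.ultrafilter_le_nhds (l.map Q) (by simp)
  have hlim : ∀ F : C(Ω × X, ℝ), Filter.Tendsto (fun i => ∫ ω, w i ω * F (ω, ξ i ω) ∂P) l
      (𝓝 (∫ z, F z ∂(R : Measure (Ω × X)))) := by
    intro F
    have hcont := ProbabilityMeasure.continuous_integral_continuousMap (X := Ω × X) F
    have : Filter.Tendsto (fun i => ∫ z, F z ∂(Q i : Measure (Ω × X))) l
      (𝓝 (∫ z, F z ∂(R : Measure (Ω × X)))) := (hcont.tendsto R).comp (f := Q) hR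
    exact this.congr fun i => hQ i F.continuous.measurable.stronglyMeasurable
  -- Reweighting by `w i` does not change `P` in the limit, because `w i - 1` tends weakly to zero
  -- in `L²`. This is what lets `R` be disintegrated over `P`.
  have hfst : (R : Measure (Ω × X)).fst = P := by
    refine ext_of_forall_integral_eq_of_IsFiniteMeasure fun g => ?_
    rw [Measure.fst, integral_map measurable_fst.aemeasurable
      g.continuous.measurable.aestronglyMeasurable]
    refine tendsto_nhds_unique (hlim ⟨fun z => g z.1, by fun_prop⟩) ?_
    have hg : MemLp g 2 P := MemLp.of_bound g.continuous.measurable.aestronglyMeasurable ‖g‖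
      (Filter.Eventually.of_forall g.norm_coe_le_norm)
    have h2 := (tendsto_integral_mul_zero_of_orthogonal (u := fun i ω => w i ω - 1) (C := C + 1)
      (fun i => (hw i).sub_const 1) (fun i ω => by
        rw [abs_le]; constructor <;> linarith [h0 i ω, hC i ω]) horth hg).mono_left hl
    have h3 := h2.add_const (∫ ω, g ω ∂P)
    rw [zero_add] at h3
    refine h3.congr fun i => ?_
    have hgi : Integrable g P := hg.integrable (by norm_num)
    have hwg : Integrable (fun ω => w i ω * g ω) P :=
      hgi.bdd_mul (c := C) (hw i).aestronglyMeasurable (Filter.Eventually.of_forall fun ω => by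
        rw [Real.norm_eq_abs, abs_of_nonneg (h0 i ω)]; exact hC i ω)
    have : (fun ω => (w i ω - 1) * g ω) = fun ω => w i ω * g ω - g ω := by ext; ring
    rw [this, integral_sub hwg hgi]
    simp
  refine ⟨(R : Measure (Ω × X)).condKernel, inferInstance, fun g B hg hB f => ?_⟩
  set κ := (R : Measure (Ω × X)).condKernel
  have hdis : ∀ {h : Ω → ℝ}, Integrable h P →
      ∫ z, h z.1 * f z.2 ∂(R : Measure (Ω × X)) = ∫ ω, h ω * ∫ x, f x ∂(κ ω) ∂P := by
    intro h hh
    have hint : Integrable (fun z : Ω × X => h z.1 * f z.2) (R : Measure (Ω × X)) := by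
      refine Integrable.mul_bdd (c := ‖f‖) ?_ (by fun_prop)
        (Filter.Eventually.of_forall fun z => f.norm_coe_le_norm z.2)
      rw [← hfst] at hh
      exact hh.comp_measurable measurable_fst
    rw [← (R : Measure (Ω × X)).disintegrate (R : Measure (Ω × X)).condKernel,
      Measure.integral_compProd (by rwa [(R : Measure (Ω × X)).disintegrate]), hfst]
    simp_rw [integral_const_mul]
    rfl
  have hfm : ∀ i, Measurable fun ω => f (ξ i ω) := fun i => f.continuous.measurable.comp (hξ i)
  have hB0 : ∀ i ω, |w i ω * f (ξ i ω)| ≤ C * ‖f‖ := fun i ω => by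
    rw [abs_mul, abs_of_nonneg (h0 i ω)]
    exact mul_le_mul (hC i ω) (f.norm_coe_le_norm _) (abs_nonneg _) ((h0 i ω).trans (hC i ω))
  have hκ : ∀ ω, |∫ x, f x ∂(κ ω)| ≤ ‖f‖ := fun ω => by
    simpa using norm_integral_le_of_norm_le_const (μ := κ ω) (f := f)
      (Filter.Eventually.of_forall f.norm_coe_le_norm)
  have hκm : StronglyMeasurable fun ω => ∫ x, f x ∂(κ ω) :=
    StronglyMeasurable.integral_kernel f.continuous.measurable.stronglyMeasurable
  have hC0 : 0 ≤ C := by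
    obtain ⟨ω⟩ := nonempty_of_isProbabilityMeasure P
    exact (h0 0 ω).trans (hC 0 ω)
  have hint1 : ∀ i {h : Ω → ℝ}, Integrable h P →
      Integrable (fun ω => w i ω * (h ω * f (ξ i ω))) P := by
    intro i h hh
    have := hh.mul_bdd (c := C * ‖f‖) (g := fun ω => w i ω * f (ξ i ω))
      ((hw i).mul (hfm i)).aestronglyMeasurable (Filter.Eventually.of_forall (hB0 i))
    refine this.congr (Filter.Eventually.of_forall fun ω => ?_)
    simp only; ring
  have hint2 : ∀ {h : Ω → ℝ}, Integrable h P → Integrable (fun ω => h ω * ∫ x, f x ∂(κ ω)) P :=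
    fun hh => hh.mul_bdd (c := ‖f‖) hκm.aestronglyMeasurable (Filter.Eventually.of_forall hκ)
  have hgi : Integrable g P := Integrable.of_bound hg.aestronglyMeasurable B
    (Filter.Eventually.of_forall hB)
  rw [Metric.tendsto_nhds]
  intro ε hε
  -- Weak convergence only tests continuous functions, so `g` is replaced by an `L¹`-close `h`. `D`
  -- dominates the factors `C * ‖f‖` and `‖f‖` multiplying the error before and after the limit.
  set D : ℝ := C * ‖f‖ + ‖f‖ + 1 with hD
  have hDpos : 0 < D := by positivity
  obtain ⟨h, hh, hhi⟩ := hgi.exists_boundedContinuous_integral_sub_le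
    (ε := ε / (3 * D)) (by positivity)
  have hgh : Integrable (fun ω => |g ω - h ω|) P := (hgi.sub hhi).abs
  have hclose : ∀ {A : ℝ}, 0 ≤ A → A ≤ D → ∫ ω, |g ω - h ω| * A ∂P ≤ ε / 3 := by
    intro A hA hAD
    rw [integral_mul_const]
    calc (∫ ω, |g ω - h ω| ∂P) * A ≤ ε / (3 * D) * D :=
          mul_le_mul hh hAD hA (by positivity)
      _ = ε / 3 := by field_simp
  have hc := Metric.tendsto_nhds.1 (hlim ⟨fun z => h z.1 * f z.2, by fun_prop⟩) (ε / 3)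
    (by positivity)
  filter_upwards [hc] with i hi
  rw [ContinuousMap.coe_mk, hdis hhi, Real.dist_eq] at hi
  have e1 := abs_le.1 <| (abs_integral_sub_le_of_abs_sub_le (hint1 i hgi) (hint1 i hhi)
    (hgh.mul_const (C * ‖f‖)) fun ω => by
      have : w i ω * (g ω * f (ξ i ω)) - w i ω * (h ω * f (ξ i ω)) =
        (g ω - h ω) * (w i ω * f (ξ i ω)) := by ring
      rw [this, abs_mul]
      exact mul_le_mul_of_nonneg_left (hB0 i ω) (abs_nonneg _)).trans
    (hclose (by positivity) (by rw [hD]; linarith [norm_nonneg f]))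
  have e2 := abs_le.1 <| (abs_integral_sub_le_of_abs_sub_le (hint2 hgi) (hint2 hhi)
    (hgh.mul_const ‖f‖) fun ω => by
      rw [← sub_mul, abs_mul]
      exact mul_le_mul_of_nonneg_left (hκ ω) (abs_nonneg _)).trans
    (hclose (by positivity) (by rw [hD]; linarith [mul_nonneg hC0 (norm_nonneg f)]))
  have hi' := abs_lt.1 hi
  rw [Real.dist_eq, abs_lt]
  constructor <;> linarith [e1.1, e1.2, e2.1, e2.2, hi'.1, hi'.2]

/-! ### The mixed product measure and free recombination. -/

/-- The product over a finite index set of Markov kernels with the same source. -/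
noncomputable def kernelPi {Ω ι X : Type*} [Fintype ι] [MeasurableSpace Ω] [MeasurableSpace X]
    (κ : ι → Kernel Ω X) [∀ j, IsMarkovKernel (κ j)] : Kernel Ω (ι → X) where
  toFun ω := Measure.pi fun j => κ j ω
  measurable' := by
    refine Measurable.measure_of_isPiSystem_of_isProbabilityMeasure generateFrom_pi.symm
      isPiSystem_pi ?_
    rintro _ ⟨s, hs, rfl⟩
    simp_rw [Measure.pi_pi]
    exact Finset.measurable_prod _ fun j _ => (κ j).measurable_coe (hs j (Set.mem_univ j))

instance isMarkovKernel_kernelPi {Ω ι X : Type*} [Fintype ι] [MeasurableSpace Ω] [MeasurableSpace X]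
    (κ : ι → Kernel Ω X) [∀ j, IsMarkovKernel (κ j)] : IsMarkovKernel (kernelPi κ) :=
  ⟨fun ω => inferInstanceAs (IsProbabilityMeasure (Measure.pi fun j => κ j ω))⟩

/-- If events occurring at each index of an infinite set of indices extend any given non-null
subset of `B t`, then they can be combined freely. -/
theorem exists_injective_forall_measure_pos {Ω T J : Type*} [Finite T] [Finite J]
    [MeasurableSpace Ω] {P : Measure Ω} {l : Ultrafilter ℕ} (hl : ↑l ≤ (Filter.atTop : Filter ℕ))
    {B : T → Set Ω} (hB : ∀ t, MeasurableSet (B t)) (hBpos : ∀ t, 0 < P (B t))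
    {E : T → J → ℕ → Set Ω} (hE : ∀ t j i, MeasurableSet (E t j i))
    (hext : ∀ t j A, MeasurableSet A → A ⊆ B t → 0 < P A → ∀ᶠ i in l, 0 < P (A ∩ E t j i)) (m : ℕ) :
    ∃ i : Fin m → ℕ, Function.Injective i ∧
      ∀ t (τ : Fin m → J), 0 < P (B t ∩ ⋂ r, E t (τ r) (i r)) := by
  induction m with
  | zero => exact ⟨Fin.elim0, fun r => r.elim0, fun t τ => by simpa using hBpos t⟩
  | succ m ih =>
    obtain ⟨i, hi, hpos⟩ := ih
    -- Every event already built is a non-null subset of `B t`, so `hext` applies to it; there are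
    -- finitely many `t`, `j`, `τ`, so one `n` works for all.
    have hev : ∀ᶠ n in (l : Filter ℕ), ∀ (t : T) (j : J) (τ : Fin m → J),
        0 < P ((B t ∩ ⋂ r, E t (τ r) (i r)) ∩ E t j n) :=
      Filter.eventually_all.2 fun t => Filter.eventually_all.2 fun j =>
        Filter.eventually_all.2 fun τ => hext t j _
          ((hB t).inter (MeasurableSet.iInter fun r => hE _ _ _)) Set.inter_subset_left (hpos t τ)
    have hnew : ∀ᶠ n in (l : Filter ℕ), ∀ r, n ≠ i r :=
      Filter.eventually_all.2 fun r => hl (Filter.eventually_ne_atTop (i r))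
    obtain ⟨n, hn, hn'⟩ := (hev.and hnew).exists
    refine ⟨Fin.cons n i, Fin.cons_injective_iff.2 ⟨fun ⟨r, hr⟩ => hn' r hr.symm, hi⟩,
      fun t τ => (hn t (τ 0) (Fin.tail τ)).trans_le (measure_mono ?_)⟩
    rintro ω ⟨⟨h1, h2⟩, h3⟩
    refine ⟨h1, Set.mem_iInter.2 fun r => ?_⟩
    refine Fin.cases ?_ (fun r => ?_) r
    · simpa using h3
    · simpa [Fin.tail] using Set.mem_iInter.1 h2 r

/-- Existence of a joint law `M` on `X^k`, mixing products of the weak limits of the laws of `ξ i`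
weighted by `w j i`, whose support consists of points that are freely visited along common
subsequences. -/
theorem exists_joint_measure {Ω X : Type*} [TopologicalSpace Ω] [CompactSpace Ω]
    [TopologicalSpace.MetrizableSpace Ω] [MeasurableSpace Ω] [BorelSpace Ω] [TopologicalSpace X]
    [CompactSpace X] [TopologicalSpace.MetrizableSpace X] [MeasurableSpace X] [BorelSpace X]
    [Nonempty X] (P : Measure Ω) [IsProbabilityMeasure P] {k : ℕ} {w : Fin k → ℕ → Ω → ℝ} {C : ℝ}
    (hw : ∀ j i, Measurable (w j i)) (h0 : ∀ j i ω, 0 ≤ w j i ω) (hC : ∀ j i ω, w j i ω ≤ C)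
    (horth : ∀ j, Pairwise fun i i' => ∫ ω, (w j i ω - 1) * (w j i' ω - 1) ∂P = 0)
    {ξ : ℕ → Ω → X} (hξ : ∀ i, Measurable (ξ i)) {μ : Fin k → ProbabilityMeasure X}
    (hμ : ∀ j i (f : C(X, ℝ)), ∫ ω, w j i ω * f (ξ i ω) ∂P = ∫ x, f x ∂(μ j : Measure X)) :
    ∃ M : ProbabilityMeasure (Fin k → X), marginal M = μ ∧
      ∀ (n m : ℕ) (x : Fin n → Fin k → X), (∀ t, x t ∈ (M : Measure (Fin k → X)).support) →
        ∀ V : Fin n → Fin k → Set X, (∀ t j, V t j ∈ 𝓝 (x t j)) →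
          ∃ i : Fin m → ℕ, Function.Injective i ∧ ∀ t (τ : Fin m → Fin k),
            0 < P {ω | ∀ r, w (τ r) (i r) ω ≠ 0 ∧ ξ (i r) ω ∈ V t (τ r)} := by
  let := TopologicalSpace.metrizableSpaceMetric X
  let l : Ultrafilter ℕ := Filter.hyperfilter ℕ
  have hl : ↑l ≤ (Filter.atTop : Filter ℕ) := Nat.hyperfilter_le_atTop
  have h1 : ∀ j i, ∫ ω, w j i ω ∂P = 1 := fun j i => by simpa using hμ j i 1
  choose κ hκ hlim using fun j =>
    exists_kernel_tendsto P hl (hw j) (h0 j) (hC j) (h1 j) (horth j) hξ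
  -- Given `ω`, the `k` coordinates are independent with laws `κ j ω`.
  let M : Measure (Fin k → X) := P.bind (kernelPi κ)
  refine ⟨⟨M, inferInstance⟩, ?_, ?_⟩
  · funext j
    have hmap : M.map (fun y => y j) = P.bind (κ j) := by
      ext s hs
      rw [Measure.map_apply (measurable_pi_apply j) hs,
        Measure.bind_apply (measurable_pi_apply j hs) (kernelPi κ).measurable.aemeasurable,
        Measure.bind_apply hs (κ j).measurable.aemeasurable]
      refine lintegral_congr fun ω => ?_
      change Measure.pi (fun j => κ j ω) (Function.eval j ⁻¹' s) = _
      rw [(measurePreserving_eval (fun j => κ j ω) j).measure_preimage hs.nullMeasurableSet]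
    refine Subtype.ext (hmap.trans ?_)
    change P.bind (κ j) = (μ j : Measure X)
    refine ext_of_forall_integral_eq_of_IsFiniteMeasure fun f => ?_
    have hint : Integrable (fun z : Ω × X => f z.2) (P.compProd (κ j)) :=
      Integrable.of_bound (f.continuous.comp continuous_snd).measurable.aestronglyMeasurable ‖f‖
        (Filter.Eventually.of_forall fun z => f.norm_coe_le_norm z.2)
    rw [← Measure.snd_compProd, Measure.snd, integral_map measurable_snd.aemeasurable
      f.continuous.measurable.aestronglyMeasurable, Measure.integral_compProd hint]
    have := hlim j (fun _ => 1) 1 measurable_const (by simp) f.toContinuousMap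
    simp only [one_mul] at this
    exact tendsto_nhds_unique this (tendsto_const_nhds.congr fun i => (hμ j i _).symm)
  · intro n m x hx V hV
    choose ρ hρ hρV using fun t j => Metric.mem_nhds_iff.1 (hV t j)
    let B : Fin n → Set Ω := fun t => {ω | ∀ j, 0 < κ j ω (Metric.ball (x t j) (ρ t j))}
    let E : Fin n → Fin k → ℕ → Set Ω := fun t j i =>
      {ω | w j i ω ≠ 0 ∧ ξ i ω ∈ Metric.ball (x t j) (ρ t j)}
    have hBm : ∀ t, MeasurableSet (B t) := fun t => by
      have : B t = ⋂ j, {ω | 0 < κ j ω (Metric.ball (x t j) (ρ t j))} := by ext; simp [B]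
      rw [this]
      exact MeasurableSet.iInter fun j =>
        measurableSet_lt measurable_const ((κ j).measurable_coe Metric.isOpen_ball.measurableSet)
    have hEm : ∀ t j i, MeasurableSet (E t j i) := fun t j i =>
      ((hw j i) (measurableSet_singleton 0).compl).inter
        (hξ i Metric.isOpen_ball.measurableSet)
    have hBpos : ∀ t, 0 < P (B t) := by
      intro t
      have hpos : 0 < M (Set.univ.pi fun j => Metric.ball (x t j) (ρ t j)) :=
        Measure.mem_support_iff_forall _ |>.1 (hx t) _ <|
          set_pi_mem_nhds Set.finite_univ fun j _ => Metric.ball_mem_nhds _ (hρ t j)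
      rw [Measure.bind_apply (MeasurableSet.univ_pi fun j => Metric.isOpen_ball.measurableSet)
        (kernelPi κ).measurable.aemeasurable] at hpos
      rw [pos_iff_ne_zero] at hpos ⊢
      -- If almost every `ω` had some `κ j ω` missing its ball, every product measure would miss the
      -- box, contradicting that `x t` is in the support.
      contrapose! hpos
      rw [lintegral_eq_zero_iff ((kernelPi κ).measurable_coe
        (MeasurableSet.univ_pi fun j => Metric.isOpen_ball.measurableSet))]
      filter_upwards [measure_eq_zero_iff_ae_notMem.1 hpos] with ω hω
      change Measure.pi (fun j => κ j ω) _ = 0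
      rw [Measure.pi_pi, Finset.prod_eq_zero_iff]
      simp only [B, Set.mem_ofPred_eq, not_forall, not_lt, nonpos_iff_eq_zero] at hω
      obtain ⟨j, hj⟩ := hω
      exact ⟨j, Finset.mem_univ j, hj⟩
    have hext : ∀ t j A, MeasurableSet A → A ⊆ B t → 0 < P A →
        ∀ᶠ i in (l : Filter ℕ), 0 < P (A ∩ E t j i) := by
      intro t j A hA hAB hApos
      -- A continuous tent, positive exactly on the ball, stands in for the indicator of the ball.
      let f : C(X, ℝ) := ⟨fun y => max 0 (ρ t j - dist y (x t j)), by fun_prop⟩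
      have hf0 : ∀ y, 0 ≤ f y := fun y => le_max_left _ _
      have hfpos : ∀ y, 0 < f y ↔ y ∈ Metric.ball (x t j) (ρ t j) := fun y => by
        simp [f]
      have hκf : ∀ ω ∈ A, 0 < ∫ y, f y ∂(κ j ω) := by
        intro ω hω
        have hint : Integrable f (κ j ω) := f.continuous.integrable_of_hasCompactSupport
          (HasCompactSupport.of_compactSpace f)
        rw [integral_pos_iff_support_of_nonneg hf0 hint]
        refine (hAB hω j).trans_le (measure_mono fun y hy => ?_)
        exact ((hfpos y).2 hy).ne'
      have hκ0 : ∀ ω, |∫ y, f y ∂(κ j ω)| ≤ ‖f‖ := fun ω => by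
        simpa using norm_integral_le_of_norm_le_const (μ := κ j ω) (f := f)
          (Filter.Eventually.of_forall f.norm_coe_le_norm)
      have hκm : StronglyMeasurable fun ω => ∫ y, f y ∂(κ j ω) :=
        StronglyMeasurable.integral_kernel f.continuous.measurable.stronglyMeasurable
      let g : Ω → ℝ := A.indicator 1
      have hg : Measurable g := measurable_one.indicator hA
      have hgle : ∀ ω, |g ω| ≤ 1 := fun ω => by
        by_cases h : ω ∈ A <;> simp [g, h]
      have hpos : 0 < ∫ ω, g ω * ∫ y, f y ∂(κ j ω) ∂P := by
        rw [integral_pos_iff_support_of_nonneg]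
        · refine hApos.trans_le (measure_mono fun ω hω => ?_)
          simpa [g, hω] using (hκf ω hω).ne'
        · intro ω
          by_cases h : ω ∈ A
          · simpa [g, h] using (hκf ω h).le
          · simp [g, h]
        · refine Integrable.of_bound (hg.aestronglyMeasurable.mul hκm.aestronglyMeasurable)
            (1 * ‖f‖) (Filter.Eventually.of_forall fun ω => ?_)
          rw [norm_mul]
          exact mul_le_mul (hgle ω) (hκ0 ω) (norm_nonneg _) zero_le_one
      filter_upwards [(hlim j g 1 hg hgle f).eventually (lt_mem_nhds hpos)] with i hi
      rw [pos_iff_ne_zero]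
      intro hzero
      refine hi.ne' (integral_eq_zero_of_ae ?_)
      filter_upwards [measure_eq_zero_iff_ae_notMem.1 hzero] with ω hω
      by_cases hωA : ω ∈ A
      · by_cases hw0 : w j i ω = 0
        · simp [hw0]
        · have hball : ξ i ω ∉ Metric.ball (x t j) (ρ t j) := fun h => hω ⟨hωA, hw0, h⟩
          have : f (ξ i ω) = 0 := le_antisymm (not_lt.1 fun h => hball ((hfpos _).1 h)) (hf0 _)
          simp [this]
      · simp [g, hωA]
    obtain ⟨i, hi, hpos⟩ := exists_injective_forall_measure_pos hl hBm hBpos hEm hext m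
    refine ⟨i, hi, fun t τ => (hpos t τ).trans_le (measure_mono ?_)⟩
    rintro ω ⟨-, h⟩ r
    obtain ⟨ha, hb⟩ := Set.mem_iInter.1 h r
    exact ⟨ha, hρV t (τ r) hb⟩

/-! ### Random words of labels and orbit records. -/

/-- The average of a finite family of probability measures. -/
noncomputable def averageMeasure {Ω S : Type*} [MeasurableSpace Ω] [Fintype S] [Nonempty S]
    (m : S → ProbabilityMeasure Ω) : ProbabilityMeasure Ω :=
  ⟨(Fintype.card S : ENNReal)⁻¹ • ∑ s, (m s : Measure Ω), ⟨by
    simp only [Measure.smul_apply, Measure.finsetSum_apply, measure_univ, Finset.sum_const,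
      Finset.card_univ, nsmul_eq_mul, mul_one, smul_eq_mul]
    exact ENNReal.inv_mul_cancel (by simp) (by simp)⟩⟩

theorem integral_averageMeasure {Ω S : Type*} [MeasurableSpace Ω] [Fintype S] [Nonempty S]
    (m : S → ProbabilityMeasure Ω) {f : Ω → ℝ} (hf : ∀ s, Integrable f (m s : Measure Ω)) :
    ∫ ω, f ω ∂(averageMeasure m : Measure Ω) =
      (Fintype.card S : ℝ)⁻¹ * ∑ s, ∫ ω, f ω ∂(m s : Measure Ω) := by
  change ∫ ω, f ω ∂((Fintype.card S : ENNReal)⁻¹ • ∑ s, (m s : Measure Ω)) = _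
  rw [integral_smul_measure, integral_finsetSum_measure fun s _ => hf s]
  simp [ENNReal.toReal_inv]

theorem exists_pos_of_averageMeasure_pos {Ω S : Type*} [MeasurableSpace Ω] [Fintype S] [Nonempty S]
    {m : S → ProbabilityMeasure Ω} {A : Set Ω} (h : 0 < (averageMeasure m : Measure Ω) A) :
    ∃ s, 0 < (m s : Measure Ω) A := by
  by_contra! hc
  refine h.ne' ?_
  change ((Fintype.card S : ENNReal)⁻¹ • ∑ s, (m s : Measure Ω)) A = 0
  simp only [Measure.smul_apply, Measure.finsetSum_apply]
  rw [Finset.sum_eq_zero fun s _ => nonpos_iff_eq_zero.1 (hc s), smul_zero]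

/-- The sum over words factors as a product over positions, and the factor at `a` is `∑ c, v c = 0`.
-/
theorem sum_pi_apply_eq_zero {ι κ : Type*} [Fintype ι] [DecidableEq ι] [Fintype κ]
    {v : κ → ℝ} (hv : ∑ c, v c = 0) (a : ι) : ∑ σ : ι → κ, v (σ a) = 0 := by
  have h := Finset.prod_univ_sum (fun _ : ι => (Finset.univ : Finset κ))
    (fun x c => if x = a then v c else 1)
  rw [Finset.prod_eq_zero (Finset.mem_univ a) (by simpa using hv), Fintype.piFinset_univ] at h
  simpa using h.symm

theorem sum_pi_apply_mul_apply_eq_zero {ι κ : Type*} [Fintype ι] [DecidableEq ι] [Fintype κ]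
    {v : κ → ℝ} (hv : ∑ c, v c = 0) {a b : ι} (hab : a ≠ b) :
    ∑ σ : ι → κ, v (σ a) * v (σ b) = 0 := by
  have h := Finset.prod_univ_sum (fun _ : ι => (Finset.univ : Finset κ))
    (fun x c => (if x = a then v c else 1) * (if x = b then v c else 1))
  rw [Finset.prod_eq_zero (Finset.mem_univ a) (by simpa [hab] using hv),
    Fintype.piFinset_univ] at h
  simp_rw [Finset.prod_mul_distrib] at h
  simpa using h.symm

/-- An IN-tuple of measures provides measures that visit neighbourhoods of its entries in any
prescribed order. -/
theorem exists_measures_of_mem_INTuples {Γ Y : Type*} [Group Γ] [TopologicalSpace Y]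
    [MulAction Γ Y] {k : ℕ} {y : Fin k → Y} (hy : y ∈ INTuples Γ Y k) {U : Fin k → Set Y}
    (hU : ∀ j, U j ∈ 𝓝 (y j)) (p : ℕ) :
    ∃ s : Fin (p + 1) → Γ, Function.Injective s ∧
      ∀ σ : Fin (p + 1) → Fin k, ∃ z : Y, ∀ i, s i • z ∈ U (σ i) := by
  obtain ⟨F, hF, hind⟩ := hy U hU (p + 1)
  obtain ⟨J, hJF, hJ⟩ := Finset.exists_subset_card_eq hF
  let e := (Finset.equivFinOfCardEq hJ).symm
  refine ⟨fun i => e i, Subtype.val_injective.comp e.injective, fun σ => ?_⟩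
  obtain ⟨z, hz⟩ := hind J (Finset.card_pos.1 (by omega)) (by exact_mod_cast hJF)
    (fun s => σ (e.symm s))
  refine ⟨z, fun i => ?_⟩
  simpa using Set.mem_iInter.1 hz (e i)

/-- The record of an orbit: the `i`-th entry consists of the label `σ i` and the point `s i • x`,
indices being read modulo `p + 1`. -/
def orbitRecord {Γ X : Type*} [SMul Γ X] {k p : ℕ} (s : Fin (p + 1) → Γ) (σ : Fin (p + 1) → Fin k)
    (x : X) : ℕ → Fin k × X := fun i => (σ (Fin.ofNat (p + 1) i), s (Fin.ofNat (p + 1) i) • x)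

/-- The weight giving mass `k` to label `j`. -/
def labelWeight (k : ℕ) (j c : Fin k) : ℝ := if c = j then k else 0

theorem sum_labelWeight_sub_one {k : ℕ} (j : Fin k) : ∑ c, (labelWeight k j c - 1) = 0 := by
  simp [labelWeight]

theorem continuous_orbitRecord {Γ X : Type*} [TopologicalSpace X] [SMul Γ X]
    [ContinuousConstSMul Γ X] {k p : ℕ} (s : Fin (p + 1) → Γ) (σ : Fin (p + 1) → Fin k) :
    Continuous (orbitRecord s σ : X → ℕ → Fin k × X) :=
  continuous_pi fun _ => continuous_const.prodMk (continuous_const_smul _)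

theorem integral_smul_probabilityMeasure {Γ X : Type*} [Group Γ] [MeasurableSpace X]
    [MulAction Γ X] [MeasurableConstSMul Γ X] (g : Γ) (ν : ProbabilityMeasure X) {f : X → ℝ}
    (hf : StronglyMeasurable f) :
    ∫ x, f x ∂((g • ν : ProbabilityMeasure X) : Measure X) = ∫ x, f (g • x) ∂(ν : Measure X) :=
  integral_map (measurable_const_smul g).aemeasurable hf.aestronglyMeasurable

theorem continuous_labelWeight_apply {X : Type*} [TopologicalSpace X] {k : ℕ} (j : Fin k) (i : ℕ) :
    Continuous fun ω : ℕ → Fin k × X => labelWeight k j (ω i).1 :=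
  (continuous_of_discreteTopology (f := labelWeight k j)).comp
    (continuous_fst.comp (continuous_apply i))

theorem ofNat_ne_ofNat {p i i' : ℕ} (hi : i ≤ p) (hi' : i' ≤ p) (h : i ≠ i') :
    Fin.ofNat (p + 1) i ≠ Fin.ofNat (p + 1) i' := by
  intro he
  have := congrArg Fin.val he
  simp only [Fin.val_ofNat] at this
  rw [Nat.mod_eq_of_lt (by omega), Nat.mod_eq_of_lt (by omega)] at this
  exact h this

/-- The law of the orbit record for a uniformly random word of labels `σ` and a point chosen
according to `ν σ`. -/
noncomputable def recordMeasure {Γ X : Type*} [Group Γ] [TopologicalSpace X] [CompactSpace X]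
    [TopologicalSpace.MetrizableSpace X] [MeasurableSpace X] [BorelSpace X] [MulAction Γ X]
    [ContinuousConstSMul Γ X] {k p : ℕ} [NeZero k] (s : Fin (p + 1) → Γ)
    (ν : (Fin (p + 1) → Fin k) → ProbabilityMeasure X) :
    ProbabilityMeasure (ℕ → Fin k × X) :=
  averageMeasure fun σ => (ν σ).map (f := orbitRecord s σ) <| by
    let := TopologicalSpace.metrizableSpaceMetric X
    exact (continuous_orbitRecord s σ).measurable.aemeasurable

section

variable {Γ X : Type*} [Group Γ] [TopologicalSpace X] [CompactSpace X]
  [TopologicalSpace.MetrizableSpace X] [MeasurableSpace X] [BorelSpace X] [MulAction Γ X]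
  [ContinuousConstSMul Γ X] {k p : ℕ} [NeZero k]

theorem integral_recordMeasure (s : Fin (p + 1) → Γ)
    (ν : (Fin (p + 1) → Fin k) → ProbabilityMeasure X) (F : C(ℕ → Fin k × X, ℝ)) :
    ∫ ω, F ω ∂(recordMeasure s ν : Measure (ℕ → Fin k × X)) =
      (Fintype.card (Fin (p + 1) → Fin k) : ℝ)⁻¹ *
        ∑ σ, ∫ x, F (orbitRecord s σ x) ∂(ν σ : Measure X) := by
  let := TopologicalSpace.metrizableSpaceMetric X
  rw [recordMeasure, integral_averageMeasure _ fun σ =>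
    F.continuous.integrable_of_hasCompactSupport (HasCompactSupport.of_compactSpace F)]
  congr 1
  refine Finset.sum_congr rfl fun σ _ => ?_
  exact integral_map (continuous_orbitRecord s σ).measurable.aemeasurable
    F.continuous.measurable.aestronglyMeasurable

theorem exists_orbitRecord_mem_of_recordMeasure_pos {s : Fin (p + 1) → Γ}
    {ν : (Fin (p + 1) → Fin k) → ProbabilityMeasure X} {A : Set (ℕ → Fin k × X)} (hA : IsOpen A)
    (h : 0 < (recordMeasure s ν : Measure (ℕ → Fin k × X)) A) :
    ∃ σ x, orbitRecord s σ x ∈ A := by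
  let := TopologicalSpace.metrizableSpaceMetric X
  obtain ⟨σ, hσ⟩ := exists_pos_of_averageMeasure_pos h
  change 0 < (ν σ : Measure X).map (orbitRecord s σ) A at hσ
  rw [Measure.map_apply (continuous_orbitRecord s σ).measurable hA.measurableSet] at hσ
  obtain ⟨x, hx⟩ := nonempty_of_measure_ne_zero hσ.ne'
  exact ⟨σ, x, hx⟩

/-- Labels do not involve the point `x`, so only the uniform choice of word matters, and its letters
at distinct positions are independent. The bounds by `p` prevent the two indices from coinciding
modulo `p + 1`. -/
theorem integral_labelWeight_recordMeasure (s : Fin (p + 1) → Γ)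
    (ν : (Fin (p + 1) → Fin k) → ProbabilityMeasure X) (j : Fin k) {i i' : ℕ} (hi : i ≤ p)
    (hi' : i' ≤ p) (h : i ≠ i') :
    ∫ ω, (labelWeight k j (ω i).1 - 1) * (labelWeight k j (ω i').1 - 1)
      ∂(recordMeasure s ν : Measure (ℕ → Fin k × X)) = 0 := by
  have := integral_recordMeasure s ν
    ⟨fun ω => (labelWeight k j (ω i).1 - 1) * (labelWeight k j (ω i').1 - 1),
      ((continuous_labelWeight_apply j i).sub continuous_const).mul
        ((continuous_labelWeight_apply j i').sub continuous_const)⟩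
  refine this.trans ?_
  simp only [ContinuousMap.coe_mk, orbitRecord, integral_const, probReal_univ, one_smul]
  rw [sum_pi_apply_mul_apply_eq_zero (v := fun c => labelWeight k j c - 1)
    (sum_labelWeight_sub_one j) (ofNat_ne_ofNat hi hi' h), mul_zero]

/-- The weight selects the words with letter `j` at the given position and has mean one, so the
integral is a convex combination of the integrals in `h`. -/
theorem abs_integral_recordMeasure_sub_le {s : Fin (p + 1) → Γ}
    {ν : (Fin (p + 1) → Fin k) → ProbabilityMeasure X} (j : Fin k) (i : ℕ) (f : C(X, ℝ)) {a ε : ℝ}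
    (h : ∀ σ r, σ r = j →
      |∫ x, f x ∂((s r • ν σ : ProbabilityMeasure X) : Measure X) - a| ≤ ε) :
    |∫ ω, labelWeight k j (ω i).1 * f (ω i).2 ∂(recordMeasure s ν : Measure (ℕ → Fin k × X)) - a|
      ≤ ε := by
  have hint := integral_recordMeasure s ν
    ⟨fun ω => labelWeight k j (ω i).1 * f (ω i).2,
      (continuous_labelWeight_apply j i).mul (by fun_prop)⟩
  simp only [ContinuousMap.coe_mk, orbitRecord] at hint
  rw [hint]
  set r := Fin.ofNat (p + 1) i
  set K : ℝ := (Fintype.card (Fin (p + 1) → Fin k) : ℝ) with hK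
  have hKpos : 0 < K := by rw [hK]; exact_mod_cast Fintype.card_pos
  have hsum : ∑ σ : Fin (p + 1) → Fin k, labelWeight k j (σ r) = K := by
    have := sum_pi_apply_eq_zero (sum_labelWeight_sub_one j) r
    rw [Finset.sum_sub_distrib] at this
    simpa [sub_eq_zero, K] using this
  have hrw : K⁻¹ * ∑ σ, ∫ x, labelWeight k j (σ r) * f (s r • x) ∂(ν σ : Measure X) - a =
      K⁻¹ * ∑ σ, labelWeight k j (σ r) *
        (∫ x, f x ∂((s r • ν σ : ProbabilityMeasure X) : Measure X) - a) := by
    simp_rw [mul_sub, Finset.sum_sub_distrib, ← Finset.sum_mul, hsum, integral_const_mul,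
      integral_smul_probabilityMeasure _ _ f.continuous.measurable.stronglyMeasurable]
    rw [mul_sub, inv_mul_cancel_left₀ hKpos.ne']
  rw [hrw, abs_mul, abs_of_pos (inv_pos.2 hKpos), inv_mul_le_iff₀ hKpos]
  refine (Finset.abs_sum_le_sum_abs _ _).trans ?_
  rw [← hsum, Finset.sum_mul]
  refine Finset.sum_le_sum fun σ _ => ?_
  by_cases hσ : σ r = j
  · rw [abs_mul, abs_of_nonneg (by simp [labelWeight, hσ])]
    exact mul_le_mul_of_nonneg_left (h σ r hσ) (by simp [labelWeight, hσ])
  · simp [labelWeight, hσ]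

end

/-! ### Construction of the IN-measure and conclusion. -/

/-- Every IN-tuple of measures is the tuple of marginals of an IN-measure. -/
theorem exists_INMeasure_of_mem_INTuples {Γ X : Type*} [Group Γ] [TopologicalSpace X]
    [CompactSpace X] [TopologicalSpace.MetrizableSpace X] [MeasurableSpace X] [BorelSpace X]
    [MulAction Γ X] [ContinuousConstSMul Γ X] {k : ℕ} (hk : 1 ≤ k)
    {μ : Fin k → ProbabilityMeasure X} (hμ : μ ∈ INTuples Γ (ProbabilityMeasure X) k) :
    ∃ M ∈ INMeasures Γ X k, marginal M = μ := by
  classical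
  let := TopologicalSpace.metrizableSpaceMetric X
  have : NeZero k := ⟨by omega⟩
  have : Nonempty X := (μ 0).nonempty
  have : TopologicalSpace.MetrizableSpace (ℕ → Fin k × X) :=
    TopologicalSpace.metrizableSpace_of_t3_secondCountable _
  choose U hU using fun j => (𝓝 (μ j)).exists_antitone_basis
  choose s hs ν hν using fun p =>
    exists_measures_of_mem_INTuples hμ (fun j => (hU j).mem p) p
  let Q : ℕ → ProbabilityMeasure (ℕ → Fin k × X) := fun p => recordMeasure (s p) (ν p)
  let l : Ultrafilter ℕ := Filter.hyperfilter ℕ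
  have hl : ↑l ≤ (Filter.atTop : Filter ℕ) := Nat.hyperfilter_le_atTop
  obtain ⟨P, -, hP⟩ := isCompact_univ.ultrafilter_le_nhds (l.map Q) (by simp)
  have hPQ : Filter.Tendsto Q l (𝓝 P) := hP
  have hlim : ∀ F : C(ℕ → Fin k × X, ℝ), Filter.Tendsto
      (fun p => ∫ ω, F ω ∂(Q p : Measure (ℕ → Fin k × X))) l
      (𝓝 (∫ ω, F ω ∂(P : Measure (ℕ → Fin k × X)))) := fun F =>
    ((ProbabilityMeasure.continuous_integral_continuousMap (X := ℕ → Fin k × X) F).tendsto P).comp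
      hPQ
  obtain ⟨M, hM, hfree⟩ := exists_joint_measure (P : Measure (ℕ → Fin k × X))
    (w := fun j i ω => labelWeight k j (ω i).1) (C := k) (ξ := fun i ω => (ω i).2) (μ := μ)
    (fun j i => (continuous_labelWeight_apply j i).measurable)
    (fun j i ω => by simp only [labelWeight]; split_ifs <;> simp)
    (fun j i ω => by simp only [labelWeight]; split_ifs <;> simp)
    (fun j i i' hii' => by
      refine tendsto_nhds_unique (hlim ⟨fun ω => (labelWeight k j (ω i).1 - 1) *
        (labelWeight k j (ω i').1 - 1), ((continuous_labelWeight_apply j i).sub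
        continuous_const).mul ((continuous_labelWeight_apply j i').sub continuous_const)⟩) ?_
      -- The correlation vanishes exactly once `p` exceeds both indices, hence also in the limit.
      refine tendsto_const_nhds.congr' ?_
      filter_upwards [hl (Filter.eventually_ge_atTop i), hl (Filter.eventually_ge_atTop i')]
        with p hi hi'
      exact (integral_labelWeight_recordMeasure (s p) (ν p) j hi hi' hii').symm)
    (fun i => by fun_prop)
    (fun j i f => by
      refine tendsto_nhds_unique (hlim ⟨fun ω => labelWeight k j (ω i).1 * f (ω i).2,
        (continuous_labelWeight_apply j i).mul (by fun_prop)⟩) ?_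
      rw [Metric.tendsto_nhds]
      intro ε hε
      have hnhds : ∀ᶠ ρ : ProbabilityMeasure X in 𝓝 (μ j),
          dist (∫ x, f x ∂(ρ : Measure X)) (∫ x, f x ∂(μ j : Measure X)) < ε / 2 :=
        (ProbabilityMeasure.continuous_integral_continuousMap (X := X) f).tendsto (μ j)
          (Metric.ball_mem_nhds _ (by positivity))
      obtain ⟨p₀, -, hp₀⟩ := (hU j).1.mem_iff.1 hnhds
      filter_upwards [hl (Filter.eventually_ge_atTop p₀)] with p hp
      refine lt_of_le_of_lt ?_ (half_lt_self hε)
      refine abs_integral_recordMeasure_sub_le j i f fun σ r hσ => ?_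
      have hmem := hν p σ r
      rw [hσ] at hmem
      exact (hp₀ ((hU j).antitone hp hmem)).le)
  refine ⟨M, fun n _ x hx V hV N => ?_, hM⟩
  choose ρ hρ hρV using fun j => Metric.mem_nhds_iff.1 (hV j)
  obtain ⟨i, hi, hpos⟩ := hfree n N x hx (fun t j => Metric.ball (x t j) (ρ j))
    fun t j => Metric.ball_mem_nhds _ (hρ j)
  let G : Fin n → (Fin N → Fin k) → Set (ℕ → Fin k × X) := fun t τ =>
    {ω | ∀ r, labelWeight k (τ r) (ω (i r)).1 ≠ 0 ∧ (ω (i r)).2 ∈ Metric.ball (x t (τ r)) (ρ (τ r))}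
  have hG : ∀ t τ, IsOpen (G t τ) := fun t τ => by
    simp only [G, Set.ofPred_forall]
    refine isOpen_iInter_of_finite fun r => ?_
    exact (isOpen_ne_fun (continuous_labelWeight_apply (τ r) (i r)) continuous_const).inter
      (Metric.isOpen_ball.preimage (continuous_snd.comp (continuous_apply (i r))))
  -- The sets `G t τ` are open, so positivity under `P` passes back to `Q p` by the portmanteau
  -- inequality. This yields actual orbits of `Γ`.
  have hev : ∀ᶠ p in (l : Filter ℕ), ∀ t τ, 0 < (Q p : Measure (ℕ → Fin k × X)) (G t τ) :=
    Filter.eventually_all.2 fun t => Filter.eventually_all.2 fun τ =>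
      Filter.eventually_lt_of_lt_liminf <| (hpos t τ).trans_le <|
        ProbabilityMeasure.le_liminf_measure_open_of_tendsto hPQ (hG t τ)
  obtain ⟨p, hp, hip⟩ := (hev.and (Filter.eventually_all.2 fun r =>
    hl (Filter.eventually_ge_atTop (i r)))).exists
  choose σ y hy using fun t τ => exists_orbitRecord_mem_of_recordMeasure_pos (hG t τ) (hp t τ)
  let γ : Fin N → Γ := fun r => s p (Fin.ofNat (p + 1) (i r))
  have hγ : Function.Injective γ := fun r r' h => by
    by_contra hne
    exact ofNat_ne_ofNat (hip r) (hip r') (hi.ne hne) (hs p h)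
  refine ⟨Finset.univ.map ⟨γ, hγ⟩, by simp, fun J _ hJF θ => ?_⟩
  -- Extend the prescription `θ` from `J` to all `N` indices; the value `0` outside `J` is never
  -- used.
  let τ : Fin N → Fin k := fun r => if h : γ r ∈ J then θ ⟨γ r, h⟩ else 0
  -- The coordinates of the witness in `X^n` are chosen separately for each `t`, but follow the same
  -- pattern `τ` at the same group elements `γ r`.
  refine ⟨fun t => y t τ, Set.mem_iInter.2 fun g => ?_⟩
  obtain ⟨r, -, hr⟩ := Finset.mem_map.1 (Finset.mem_coe.1 (hJF g.2))
  have hr' : γ r = g := hr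
  have hτ : τ r = θ g := by
    have hmem : γ r ∈ J := hr' ▸ g.2
    have hg : (⟨γ r, hmem⟩ : J) = g := Subtype.ext hr'
    simp only [τ, dif_pos hmem, hg]
  refine hρV (θ g) ?_
  rw [Metric.mem_ball, dist_pi_lt_iff (hρ _)]
  intro t
  have := (hy t τ r).2
  rw [hτ] at this
  rw [← hr']
  exact Metric.mem_ball.1 this

theorem theorem1p4 {Γ X : Type*} [Group Γ] [Countable Γ]
    [TopologicalSpace X] [CompactSpace X] [TopologicalSpace.MetrizableSpace X]
    [MeasurableSpace X] [BorelSpace X] [MulAction Γ X] [ContinuousConstSMul Γ X]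
    (k : ℕ) (hk : 1 ≤ k) :
    tupleToDual '' INTuples Γ (ProbabilityMeasure X) k ⊆
        closedConvexHull ℝ (tupleToDual '' (tupleDirac '' INTuples Γ X k)) ∧
      INTuples Γ (ProbabilityMeasure X) k ∩ Set.range (tupleDirac (X := X)) =
        tupleDirac '' INTuples Γ X k ∧
      INTuples Γ (ProbabilityMeasure X) k = marginal '' INMeasures Γ X k := by
  refine ⟨?_, ?_, ?_⟩
  · rintro _ ⟨μ, hμ, rfl⟩
    obtain ⟨M, hM, rfl⟩ := exists_INMeasure_of_mem_INTuples hk hμ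
    exact tupleToDual_marginal_mem_closedConvexHull (support_subset_INTuples hM)
  · refine Set.Subset.antisymm ?_ ?_
    · rintro _ ⟨hμ, x, rfl⟩
      obtain ⟨M, hM, hMx⟩ := exists_INMeasure_of_mem_INTuples hk hμ
      exact ⟨x, support_subset_INTuples hM (mem_support_of_marginal_eq_tupleDirac hMx), rfl⟩
    · rintro _ ⟨x, hx, rfl⟩
      exact ⟨tupleDirac_mem_INTuples hx, x, rfl⟩
  · refine Set.Subset.antisymm (fun μ hμ => ?_) ?_
    · exact exists_INMeasure_of_mem_INTuples hk hμ
    · rintro _ ⟨M, hM, rfl⟩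
      exact marginal_mem_INTuples hM
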